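/- An election with $m$ candidates and $n$ voters is a tuple $P=(V_1,\dots,V_n)$ of total orders (preferences) on the candidate set $[m]=\{1,\dots,m\}$; write $x>_{V_i}y$ if voter $i$ prefers $x$ to $y$. The election is \emph{group-separable} if every subset $C'\subseteq[m]$ with at least two elements can be partitioned into two nonempty blocks $A,B$ such that each voter ranks all candidates of $A$ above all candidates of $B$ or all candidates of $B$ above all candidates of $A$. It is \emph{enriched group-separable} if it is group-separable and there do not exist two distinct voters $i,j$ and four distinct candidates $a,b,c,d$ such that $V_i$ orders them as $a>b>c>d$ and $V_j$ orders them as $b>a>d>c$, nor two distinct voters $i,j$ and four distinct candidates $a,b,c,d$ such that $V_i$ orders them as $a>c>b>d$ and $V_j$ orders them as $b>d>a>c$. Let $n\ge 1$. For $m\ge 0$ let $f(m,n)$ be the number of enriched group-separable elections with $m$ candidates and $n$ voters, and let $f_r(m,n)$ be the number of those in which the preference of one given voter is a fixed total order. Then $f_r(m,n)$ depends neither on the choice of the voter nor on the choice of the fixed total order, and $$f_r(0,n)=f_r(1,n)=1,\qquad f_r(m,n)=2^n f_r(m-1,n)-2^{n-1}f_r(m-2,n)\quad (m\ge 2).$$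 Moreover $f(m,n)=m!\cdot f_r(m,n)$ for all $m\ge 0$. -/

import Mathlib

/-- The tuple of preferences of an election with candidate set `C` and `n` voters
`0, …, n - 1`: each preference is a total order (no ties) on `C`. -/
abbrev Profile (C : Type*) (n : ℕ) : Type _ := Fin n → LinearOrder C

/-- `Prefers V x y` is `x >_V y`: in the preference `V`, candidate `x` is preferred to `y`. -/
def Prefers {C : Type*} (V : LinearOrder C) (x y : C) : Prop := V.lt y x

/-- The election `P` contains the configuration `T`. -/
def ContainsConfig {C S : Type*} {n l : ℕ} (P : Profile C n) (T : Profile S l) : Prop :=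
  ∃ (f : Fin l → Fin n) (g : S → C), Function.Injective f ∧ Function.Injective g ∧
    ∀ (x y : S) (i : Fin l), Prefers (T i) x y → Prefers (P (f i)) (g x) (g y)

/-- An election is group-separable if every set `C'` of at least two candidates is the disjoint
union of two nonempty blocks `A` and `B` such that each voter ranks all of `A` above all of `B`
or all of `B` above all of `A`. -/
def GroupSeparable {C : Type*} {n : ℕ} (P : Profile C n) : Prop :=
  ∀ C' : Set C, C'.Nontrivial →
    ∃ A B : Set C, A.Nonempty ∧ B.Nonempty ∧ Disjoint A B ∧ A ∪ B = C' ∧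
      ∀ i : Fin n, (∀ a ∈ A, ∀ b ∈ B, Prefers (P i) a b) ∨
        (∀ a ∈ A, ∀ b ∈ B, Prefers (P i) b a)

/-- The preference given by a word that lists all candidates, the most preferred one first. -/
@[reducible] def orderOfWord {S : Type*} [DecidableEq S] (w : List S) (hw : ∀ x, x ∈ w) : LinearOrder S :=
  LinearOrder.lift' (fun x : S => OrderDual.toDual (w.idxOf x))
    (fun x _ h => (List.idxOf_inj (hw x)).1 (OrderDual.toDual.injective h))

theorem prefers_orderOfWord {S : Type*} [DecidableEq S] (w : List S) (hw : ∀ x, x ∈ w) (x y : S) :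
    Prefers (orderOfWord w hw) x y ↔ w.idxOf x < w.idxOf y :=
  Iff.rfl

/-- The configuration `(abcd, badc)`, with `a, b, c, d` written as `0, 1, 2, 3`. -/
@[reducible] def configABCD_BADC : Profile (Fin 4) 2 :=
  ![orderOfWord [0, 1, 2, 3] (by decide), orderOfWord [1, 0, 3, 2] (by decide)]

/-- The configuration `(acbd, bdac)`, with `a, b, c, d` written as `0, 1, 2, 3`. -/
@[reducible] def configACBD_BDAC : Profile (Fin 4) 2 :=
  ![orderOfWord [0, 2, 1, 3] (by decide), orderOfWord [1, 3, 0, 2] (by decide)]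

/-- Enriched group-separable elections. -/
def EnrichedGroupSeparable {C : Type*} {n : ℕ} (P : Profile C n) : Prop :=
  GroupSeparable P ∧ ¬ ContainsConfig P configABCD_BADC ∧ ¬ ContainsConfig P configACBD_BDAC

/-- `f(m, n)`: the number of enriched group-separable elections with `m` candidates and `n`
voters. -/
noncomputable def enrichedCount (m n : ℕ) : ℕ :=
  Nat.card {P : Profile (Fin m) n // EnrichedGroupSeparable P}

/-- `f_r(m, n)`: the number of enriched group-separable elections with `m` candidates and `n`
voters in which the preference of the voter `i` is fixed to be `V`. -/
noncomputable def enrichedFixedCount (m n : ℕ) (i : Fin n) (V : LinearOrder (Fin m)) : ℕ :=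
  Nat.card {P : Profile (Fin m) n // EnrichedGroupSeparable P ∧ P i = V}

/-! Enriched group-separability is equivalent to `Peelable` (`enrichedGroupSeparable_iff_peelable`).
Given blocks `A`, `B`, orient each voter so that `A` points away from `B`. If all voters agree on
the outward order of one block, its outermost member is extreme for everyone; disagreement in both
blocks produces a forbidden configuration. Conversely, in both configurations every candidate is
interior for some voter, which peeling forbids.

To count, fix the preference `V` of one voter, with top `t` and bottom `b`. A candidate extreme for
all voters must be `t` or `b`. Removing one of them leaves a peelable election on one candidate
fewer, and each other voter had two places for it, giving `2 ^ (n - 1)` times the smaller count. If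
both are extreme for all, each other voter only chooses which is first: the same factor, with two
candidates fewer. Inclusion–exclusion gives the recurrence (`peelCount_recurrence`); `ncard_layered`
counts both cases at once. -/

/-! ### Linear orders as preferences -/

theorem LinearOrder.eq_of_lt_imp {C : Type*} {V W : LinearOrder C}
    (h : ∀ x y, V.lt x y → W.lt x y) : V = W := by
  refine LinearOrder.ext_lt fun x y => ⟨h x y, fun hw => ?_⟩
  rcases @lt_trichotomy C V x y with h1 | h1 | h1
  · exact h1
  · subst h1; exact absurd hw (@lt_irrefl C W.toPreorder x)
  · exact absurd (h _ _ h1) (@lt_asymm C W.toPreorder _ _ hw)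

instance {C : Type*} [Finite C] : Finite (LinearOrder C) :=
  Finite.of_injective (fun V : LinearOrder C => V.lt) fun V W h =>
    LinearOrder.eq_of_lt_imp fun x y hxy => by
      have h' : V.lt = W.lt := h
      rwa [h'] at hxy

theorem Prefers.trans {C : Type*} {V : LinearOrder C} {x y z : C} (h : Prefers V x y)
    (h' : Prefers V y z) : Prefers V x z :=
  @lt_trans C V.toPreorder _ _ _ h' h

theorem Prefers.asymm {C : Type*} {V : LinearOrder C} {x y : C} (h : Prefers V x y) :
    ¬ Prefers V y x :=
  @lt_asymm C V.toPreorder _ _ h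

theorem Prefers.ne {C : Type*} {V : LinearOrder C} {x y : C} (h : Prefers V x y) : x ≠ y :=
  (@ne_of_lt C V.toPreorder _ _ h).symm

theorem prefers_or_of_ne {C : Type*} (V : LinearOrder C) {x y : C} (h : x ≠ y) :
    Prefers V x y ∨ Prefers V y x :=
  (@lt_or_gt_of_ne C V _ _ h).symm

theorem exists_top_mem {C : Type*} [Finite C] (V : LinearOrder C) {A : Set C} (hA : A.Nonempty) :
    ∃ a ∈ A, ∀ x ∈ A, x ≠ a → Prefers V a x := by
  let := V
  obtain ⟨a, ha, h⟩ := Set.exists_max_image A id A.toFinite hA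
  exact ⟨a, ha, fun x hx hne => lt_of_le_of_ne (h x hx) hne⟩

theorem exists_bottom_mem {C : Type*} [Finite C] (V : LinearOrder C) {A : Set C}
    (hA : A.Nonempty) : ∃ a ∈ A, ∀ x ∈ A, x ≠ a → Prefers V x a := by
  let := V
  obtain ⟨a, ha, h⟩ := Set.exists_min_image A id A.toFinite hA
  exact ⟨a, ha, fun x hx hne => lt_of_le_of_ne (h x hx) hne.symm⟩

/-! ### Peelability and the forbidden configurations -/

/-- Every nonempty set of candidates has a member that every voter ranks first or last in it. -/
def Peelable {C : Type*} {n : ℕ} (P : Profile C n) : Prop :=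
  ∀ C' : Set C, C'.Nonempty → ∃ c ∈ C', ∀ i, (∀ x ∈ C', x ≠ c → Prefers (P i) c x) ∨
    (∀ x ∈ C', x ≠ c → Prefers (P i) x c)

theorem injective_vec_four {C : Type*} {V : LinearOrder C} {a b c d : C} (hab : Prefers V a b)
    (hbc : Prefers V b c) (hcd : Prefers V c d) : Function.Injective ![a, b, c, d] := by
  have h1 := hab.ne
  have h2 := hbc.ne
  have h3 := hcd.ne
  have h4 := (hab.trans hbc).ne
  have h5 := (hbc.trans hcd).ne
  have h6 := ((hab.trans hbc).trans hcd).ne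
  intro x y
  fin_cases x <;> fin_cases y <;> simp [*, Ne.symm h1, Ne.symm h2, Ne.symm h3, Ne.symm h4,
    Ne.symm h5, Ne.symm h6]

theorem containsConfig_abcd_badc {C : Type*} {n : ℕ} {P : Profile C n} {i j : Fin n} (hij : i ≠ j)
    {a b c d : C} (h1 : Prefers (P i) a b) (h2 : Prefers (P i) b c) (h3 : Prefers (P i) c d)
    (h4 : Prefers (P j) b a) (h5 : Prefers (P j) a d) (h6 : Prefers (P j) d c) :
    ContainsConfig P configABCD_BADC := by
  have hg := injective_vec_four h1 h2 h3
  refine ⟨![i, j], ![a, b, c, d], ?_, hg, ?_⟩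
  · intro x y
    fin_cases x <;> fin_cases y <;> simp [hij, hij.symm]
  · have h12 := h1.trans h2
    have h23 := h2.trans h3
    have h123 := h12.trans h3
    have h45 := h4.trans h5
    have h56 := h5.trans h6
    have h456 := h45.trans h6
    intro x y k
    fin_cases k
    · change List.idxOf x [0, 1, 2, 3] < List.idxOf y [0, 1, 2, 3] → _
      fin_cases x <;> fin_cases y <;> first
        | exact fun h => absurd h (by decide)
        | exact fun _ => by assumption
    · change List.idxOf x [1, 0, 3, 2] < List.idxOf y [1, 0, 3, 2] → _
      fin_cases x <;> fin_cases y <;> first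
        | exact fun h => absurd h (by decide)
        | exact fun _ => by assumption

theorem containsConfig_acbd_bdac {C : Type*} {n : ℕ} {P : Profile C n} {i j : Fin n} (hij : i ≠ j)
    {a b c d : C} (h1 : Prefers (P i) a c) (h2 : Prefers (P i) c b) (h3 : Prefers (P i) b d)
    (h4 : Prefers (P j) b d) (h5 : Prefers (P j) d a) (h6 : Prefers (P j) a c) :
    ContainsConfig P configACBD_BDAC := by
  have hg : Function.Injective ![a, b, c, d] := by
    have := injective_vec_four h1 h2 h3
    have h' : ![a, b, c, d] = ![a, c, b, d] ∘ Equiv.swap (1 : Fin 4) 2 := by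
      ext x; fin_cases x <;> rfl
    rw [h']
    exact this.comp (Equiv.injective _)
  refine ⟨![i, j], ![a, b, c, d], ?_, hg, ?_⟩
  · intro x y
    fin_cases x <;> fin_cases y <;> simp [hij, hij.symm]
  · have h12 := h1.trans h2
    have h23 := h2.trans h3
    have h123 := h12.trans h3
    have h45 := h4.trans h5
    have h56 := h5.trans h6
    have h456 := h45.trans h6
    intro x y k
    fin_cases k
    · change List.idxOf x [0, 2, 1, 3] < List.idxOf y [0, 2, 1, 3] → _
      fin_cases x <;> fin_cases y <;> first
        | exact fun h => absurd h (by decide)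
        | exact fun _ => by assumption
    · change List.idxOf x [1, 3, 0, 2] < List.idxOf y [1, 3, 0, 2] → _
      fin_cases x <;> fin_cases y <;> first
        | exact fun h => absurd h (by decide)
        | exact fun _ => by assumption

/-- `Outward V s x y`: `x` is further up than `y` if `s` is true, further down if `s` is false. -/
def Outward {C : Type*} (V : LinearOrder C) (s : Bool) (x y : C) : Prop :=
  if s then Prefers V x y else Prefers V y x

theorem Outward.asymm {C : Type*} {V : LinearOrder C} {s : Bool} {x y : C} (h : Outward V s x y) :
    ¬ Outward V s y x := by
  cases s <;> exact Prefers.asymm h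

theorem outward_or_of_ne {C : Type*} (V : LinearOrder C) (s : Bool) {x y : C} (h : x ≠ y) :
    Outward V s x y ∨ Outward V s y x := by
  cases s
  · exact (prefers_or_of_ne V h).symm
  · exact prefers_or_of_ne V h

theorem exists_outward_mem {C : Type*} [Finite C] (V : LinearOrder C) (s : Bool) {A : Set C}
    (hA : A.Nonempty) : ∃ a ∈ A, ∀ x ∈ A, x ≠ a → Outward V s a x := by
  cases s
  · exact exists_bottom_mem V hA
  · exact exists_top_mem V hA

/-- Two voters who both reverse the outward order in both blocks yield a forbidden
configuration. -/
theorem containsConfig_of_outward {C : Type*} {n : ℕ} {P : Profile C n} {s : Fin n → Bool}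
    {A B : Set C} (hs : ∀ i, ∀ a ∈ A, ∀ b ∈ B, Outward (P i) (s i) a b) {a a' b b' : C}
    (ha : a ∈ A) (ha' : a' ∈ A) (hb : b ∈ B) (hb' : b' ∈ B) {p q : Fin n}
    (h1 : Outward (P p) (s p) a a') (h2 : Outward (P q) (s q) a' a)
    (h3 : Outward (P p) (!s p) b b') (h4 : Outward (P q) (!s q) b' b) :
    ContainsConfig P configABCD_BADC ∨ ContainsConfig P configACBD_BDAC := by
  have hpq : p ≠ q := by
    rintro rfl
    exact h1.asymm h2
  have k1 := hs p a ha b hb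
  have k2 := hs p a' ha' b' hb'
  have k3 := hs q a ha b hb
  have k4 := hs q a' ha' b' hb'
  -- Equal orientations give `configABCD_BADC`, opposite ones `configACBD_BDAC`.
  cases hp : s p <;> cases hq : s q <;> simp only [hp, hq, Outward, Bool.not_true,
    Bool.not_false, if_true, Bool.false_eq_true, if_false] at h1 h2 h3 h4 k1 k2 k3 k4
  · exact Or.inl (containsConfig_abcd_badc hpq h3 k2 h1 h4 k3 h2)
  · exact Or.inr (containsConfig_acbd_bdac hpq.symm h2 k3 h4 h3 k2 h1)
  · exact Or.inr (containsConfig_acbd_bdac hpq h1 k2 h3 h4 k3 h2)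
  · exact Or.inl (containsConfig_abcd_badc hpq h1 k2 h3 h2 k3 h4)

/-- The outermost member of `A` for one voter is outermost for all by `hc`, and all of `A` already
lies outward of `B`. -/
theorem exists_extreme_of_outward_const {C : Type*} [Finite C] {n : ℕ} {P : Profile C n}
    {s : Fin n → Bool} {A B : Set C} (hs : ∀ i, ∀ a ∈ A, ∀ b ∈ B, Outward (P i) (s i) a b)
    (hA : A.Nonempty) (i₀ : Fin n)
    (hc : ∀ a ∈ A, ∀ a' ∈ A, ∀ i j, Outward (P i) (s i) a a' → Outward (P j) (s j) a a') :
    ∃ c ∈ A, ∀ i, (∀ x ∈ A ∪ B, x ≠ c → Prefers (P i) c x) ∨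
      (∀ x ∈ A ∪ B, x ≠ c → Prefers (P i) x c) := by
  obtain ⟨c, hcA, h⟩ := exists_outward_mem (P i₀) (s i₀) hA
  refine ⟨c, hcA, fun i => ?_⟩
  have key : ∀ x ∈ A ∪ B, x ≠ c → Outward (P i) (s i) c x := by
    rintro x (hx | hx) hne
    · exact hc c hcA x hx _ _ (h x hx hne)
    · exact hs i c hcA x hx
  cases hi : s i <;> rw [hi] at key
  · exact Or.inr key
  · exact Or.inl key

theorem EnrichedGroupSeparable.peelable {C : Type*} [Finite C] {n : ℕ} {P : Profile C n}
    (hP : EnrichedGroupSeparable P) (i₀ : Fin n) : Peelable P := by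
  intro C' hC'
  by_cases hnt : C'.Nontrivial
  swap
  · obtain ⟨c, hc⟩ := hC'
    rw [Set.not_nontrivial_iff] at hnt
    exact ⟨c, hc, fun i => Or.inl fun x hx hne => absurd (hnt hx hc) hne⟩
  obtain ⟨hG, hX, hY⟩ := hP
  obtain ⟨A, B, hA, hB, -, rfl, hAB⟩ := hG C' hnt
  have hs : ∀ i, ∃ s : Bool, ∀ a ∈ A, ∀ b ∈ B, Outward (P i) s a b := fun i => by
    rcases hAB i with h | h
    · exact ⟨true, h⟩
    · exact ⟨false, h⟩
  choose s hs using hs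
  have hs' : ∀ i, ∀ b ∈ B, ∀ a ∈ A, Outward (P i) (!s i) b a := fun i b hb a ha => by
    have := hs i a ha b hb
    cases hi : s i <;> rw [hi] at this <;> exact this
  by_cases hcA : ∀ a ∈ A, ∀ a' ∈ A, ∀ i j, Outward (P i) (s i) a a' → Outward (P j) (s j) a a'
  · obtain ⟨c, hc, h⟩ := exists_extreme_of_outward_const hs hA i₀ hcA
    exact ⟨c, Or.inl hc, h⟩
  by_cases hcB : ∀ b ∈ B, ∀ b' ∈ B, ∀ i j,
      Outward (P i) (!s i) b b' → Outward (P j) (!s j) b b'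
  · obtain ⟨c, hc, h⟩ := exists_extreme_of_outward_const (s := fun i => !s i) hs' hB i₀ hcB
    rw [Set.union_comm]
    exact ⟨c, Or.inl hc, h⟩
  exfalso
  push Not at hcA hcB
  obtain ⟨a, ha, a', ha', i, j, hi, hj⟩ := hcA
  obtain ⟨b, hb, b', hb', k, l, hk, hl⟩ := hcB
  have hne : a ≠ a' := by rintro rfl; exact hi.asymm hi
  have hne' : b ≠ b' := by rintro rfl; exact hk.asymm hk
  have hx : ∀ p, ¬ Outward (P p) (s p) a a' → Outward (P p) (s p) a' a :=
    fun p h => (outward_or_of_ne _ _ hne).resolve_left h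
  have hy : ∀ p, ¬ Outward (P p) (!s p) b b' → Outward (P p) (!s p) b' b :=
    fun p h => (outward_or_of_ne _ _ hne').resolve_left h
  -- Voters who differ on `a, a'` must agree on `b, b'`. Since `i` and `j` differ on the first pair,
  -- any voter differs from one of them there; so all voters agree with `i` and `j` on the second
  -- pair, contradicting `k` and `l`.
  have hno : ∀ p q, Outward (P p) (s p) a a' → ¬ Outward (P q) (s q) a a' →
      (Outward (P p) (!s p) b b' ↔ Outward (P q) (!s q) b b') := by
    intro p q hp hq
    by_contra hpq
    have : ContainsConfig P configABCD_BADC ∨ ContainsConfig P configACBD_BDAC := by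
      by_cases h1 : Outward (P p) (!s p) b b'
      · exact containsConfig_of_outward hs ha ha' hb hb' hp (hx q hq) h1 (hy q (by tauto))
      · exact containsConfig_of_outward hs ha ha' hb' hb hp (hx q hq) (hy p h1) (by tauto)
    tauto
  have h1 := hno i j hi hj
  have h2 := hno i k hi
  have h3 := hno i l hi
  have h4 := fun h => hno k j h hj
  have h5 := fun h => hno l j h hj
  tauto

/-- Peeling the image of `T` would yield a candidate extreme for every voter, yet by `hT` each one
lies strictly between two others for some voter. -/
theorem Peelable.not_containsConfig {C S : Type*} [Nonempty S] {n l : ℕ} {P : Profile C n}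
    (hP : Peelable P) {T : Profile S l}
    (hT : ∀ s : S, ∃ k : Fin l, ∃ x y, Prefers (T k) x s ∧ Prefers (T k) s y) :
    ¬ ContainsConfig P T := by
  rintro ⟨f, g, -, -, h⟩
  obtain ⟨_, ⟨s, rfl⟩, hc⟩ := hP (Set.range g) (Set.range_nonempty g)
  obtain ⟨k, x, y, hx, hy⟩ := hT s
  have hx' := h _ _ _ hx
  have hy' := h _ _ _ hy
  rcases hc (f k) with h' | h'
  · exact hx'.asymm (h' _ ⟨x, rfl⟩ hx'.ne)
  · exact hy'.asymm (h' _ ⟨y, rfl⟩ hy'.ne.symm)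

theorem Peelable.enrichedGroupSeparable {C : Type*} {n : ℕ} {P : Profile C n}
    (hP : Peelable P) : EnrichedGroupSeparable P := by
  refine ⟨fun C' hC' => ?_, hP.not_containsConfig fun s => ?_, hP.not_containsConfig fun s => ?_⟩
  · obtain ⟨c, hc, h⟩ := hP C' hC'.nonempty
    obtain ⟨d, hd, hdc⟩ := hC'.exists_ne c
    refine ⟨{c}, C' \ {c}, Set.singleton_nonempty c, ⟨d, hd, hdc⟩, Set.disjoint_sdiff_right,
      Set.union_sdiff_cancel (Set.singleton_subset_iff.2 hc), fun i => ?_⟩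
    rcases h i with h | h
    · left
      rintro a rfl b ⟨hb, hba⟩
      exact h b hb hba
    · right
      rintro a rfl b ⟨hb, hba⟩
      exact h b hb hba
  · fin_cases s
    · exact ⟨1, 1, 2, (prefers_orderOfWord _ (by decide) _ _).2 (by decide),
        (prefers_orderOfWord _ (by decide) _ _).2 (by decide)⟩
    · exact ⟨0, 0, 2, (prefers_orderOfWord _ (by decide) _ _).2 (by decide),
        (prefers_orderOfWord _ (by decide) _ _).2 (by decide)⟩
    · exact ⟨0, 0, 3, (prefers_orderOfWord _ (by decide) _ _).2 (by decide),
        (prefers_orderOfWord _ (by decide) _ _).2 (by decide)⟩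
    · exact ⟨1, 1, 2, (prefers_orderOfWord _ (by decide) _ _).2 (by decide),
        (prefers_orderOfWord _ (by decide) _ _).2 (by decide)⟩
  · fin_cases s
    · exact ⟨1, 1, 2, (prefers_orderOfWord _ (by decide) _ _).2 (by decide),
        (prefers_orderOfWord _ (by decide) _ _).2 (by decide)⟩
    · exact ⟨0, 0, 3, (prefers_orderOfWord _ (by decide) _ _).2 (by decide),
        (prefers_orderOfWord _ (by decide) _ _).2 (by decide)⟩
    · exact ⟨0, 0, 3, (prefers_orderOfWord _ (by decide) _ _).2 (by decide),
        (prefers_orderOfWord _ (by decide) _ _).2 (by decide)⟩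
    · exact ⟨1, 1, 2, (prefers_orderOfWord _ (by decide) _ _).2 (by decide),
        (prefers_orderOfWord _ (by decide) _ _).2 (by decide)⟩

theorem enrichedGroupSeparable_iff_peelable {C : Type*} [Finite C] {n : ℕ} (i₀ : Fin n)
    {P : Profile C n} : EnrichedGroupSeparable P ↔ Peelable P :=
  ⟨fun h => h.peelable i₀, Peelable.enrichedGroupSeparable⟩

/-! ### Relabelling candidates and voters -/

/-- The preference induced on `D` by an injection of `D` into the candidate set. -/
@[reducible] def pullOrder {C D : Type*} (f : D → C) (hf : Function.Injective f) (V : LinearOrder C) :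
    LinearOrder D :=
  @LinearOrder.lift' D C V f hf

theorem prefers_pullOrder {C D : Type*} (f : D → C) (hf : Function.Injective f)
    (V : LinearOrder C) (x y : D) :
    Prefers (pullOrder f hf V) x y ↔ Prefers V (f x) (f y) :=
  Iff.rfl

theorem eq_of_prefers_imp {C : Type*} {V W : LinearOrder C}
    (h : ∀ x y, Prefers V x y → Prefers W x y) : V = W :=
  LinearOrder.eq_of_lt_imp fun x y => h y x

theorem Peelable.pull {C D : Type*} {n : ℕ} {P : Profile C n} (hP : Peelable P) (f : D → C)
    (hf : Function.Injective f) : Peelable fun i => pullOrder f hf (P i) := by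
  intro C' hC'
  obtain ⟨_, ⟨c, hc, rfl⟩, h⟩ := hP (f '' C') (hC'.image f)
  exact ⟨c, hc, fun i => (h i).imp
    (fun h x hx hne => h (f x) ⟨x, hx, rfl⟩ (hf.ne hne))
    (fun h x hx hne => h (f x) ⟨x, hx, rfl⟩ (hf.ne hne))⟩

/-- Relabelling of the candidates. -/
def pullOrderEquiv {C D : Type*} (e : D ≃ C) : LinearOrder C ≃ LinearOrder D where
  toFun := pullOrder e e.injective
  invFun := pullOrder e.symm e.symm.injective
  left_inv V := eq_of_prefers_imp fun x y h => by
    simpa only [prefers_pullOrder, Equiv.apply_symm_apply] using h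
  right_inv V := eq_of_prefers_imp fun x y h => by
    simpa only [prefers_pullOrder, Equiv.symm_apply_apply] using h

/-- The number of peelable elections in which voter `i` has the preference `V`. -/
noncomputable def peelCount {C : Type*} {n : ℕ} (i : Fin n) (V : LinearOrder C) : ℕ :=
  Nat.card {P : Profile C n // Peelable P ∧ P i = V}

theorem peelCount_pullOrder {C D : Type*} {n : ℕ} (i : Fin n) (V : LinearOrder C) (e : D ≃ C) :
    peelCount i (pullOrder e e.injective V) = peelCount i V := by
  refine Nat.card_congr (Equiv.subtypeEquiv
    (Equiv.piCongrRight fun _ => pullOrderEquiv e) fun P => ?_).symm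
  have h1 : Peelable P ↔ Peelable fun i => pullOrder e e.injective (P i) := by
    refine ⟨fun h => h.pull e e.injective, fun h => ?_⟩
    have h2 := h.pull e.symm e.symm.injective
    convert h2 using 2 with i
    exact ((pullOrderEquiv e).symm_apply_apply (P i)).symm
  have h2 : P i = V ↔ pullOrder e e.injective (P i) = pullOrder e e.injective V :=
    (pullOrderEquiv e).injective.eq_iff.symm
  rw [h1, h2]
  rfl

theorem exists_pullOrder_eq {C D : Type*} [Fintype C] [Fintype D]
    (h : Fintype.card C = Fintype.card D) (V : LinearOrder C) (W : LinearOrder D) :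
    ∃ e : D ≃ C, pullOrder e e.injective V = W := by
  let e₁ := @Fintype.orderIsoFinOfCardEq C V _ _ rfl
  let e₂ := @Fintype.orderIsoFinOfCardEq D W _ _ h.symm
  let e := e₂.symm.trans e₁
  refine ⟨e.toEquiv, (LinearOrder.eq_of_lt_imp fun x y hxy => ?_).symm⟩
  exact e.lt_iff_lt.2 hxy

/-- Any two finite linear orders of equal size are isomorphic, which handles the preference;
swapping `i` and `j` handles the voter. -/
theorem peelCount_eq {C D : Type*} [Fintype C] [Fintype D] {n : ℕ} (i j : Fin n)
    (h : Fintype.card C = Fintype.card D) (V : LinearOrder C) (W : LinearOrder D) :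
    peelCount i V = peelCount j W := by
  obtain ⟨e, rfl⟩ := exists_pullOrder_eq h V W
  rw [peelCount_pullOrder]
  refine Nat.card_congr (Equiv.subtypeEquiv (Equiv.arrowCongr (Equiv.swap i j) (Equiv.refl _))
    fun P => ?_)
  have key : ∀ (σ : Equiv.Perm (Fin n)) {P : Profile C n}, Peelable P → Peelable (P ∘ σ) := by
    intro σ P hP C' hC'
    obtain ⟨c, hc, h⟩ := hP C' hC'
    exact ⟨c, hc, fun i => h (σ i)⟩
  have h1 : Peelable P ↔ Peelable (P ∘ Equiv.swap i j) := by
    refine ⟨key _, fun h => ?_⟩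
    have := key (Equiv.swap i j) h
    rwa [Function.comp_assoc, ← Equiv.coe_trans, Equiv.swap_swap] at this
  rw [h1]
  simp [Equiv.arrowCongr]

/-! ### Layered preferences -/

/-- `V` ranks candidates of higher layer above those of lower layer. -/
def LayerRespecting {C : Type*} (h : C → SignType) (V : LinearOrder C) : Prop :=
  ∀ x y, h y < h x → Prefers V x y

/-- The preferences that respect the layers `h`, upwards or downwards. -/
def layeredOrders {C : Type*} (h : C → SignType) : Set (LinearOrder C) :=
  {V | LayerRespecting h V ∨ LayerRespecting (-h) V}

/-- The induced preference on the middle layer. -/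
@[reducible] def middleOrder {C : Type*} (h : C → SignType) (V : LinearOrder C) :
    LinearOrder {x // h x = 0} :=
  pullOrder Subtype.val Subtype.val_injective V

theorem exists_layerRespecting {C : Type*} {h k : C → SignType}
    (hk : ∀ x, k x = 0 ↔ h x = 0) (hinj : ∀ x y, k x = k y → k x ≠ 0 → x = y)
    (U : LinearOrder {x // h x = 0}) :
    ∃ V : LinearOrder C, LayerRespecting k V ∧ middleOrder h V = U := by
  classical
  -- Lexicographic: layer first, then `U` inside the middle layer. The dummy `⊥` is harmless because
  -- the other layers have at most one element.
  let f : C → SignType ×ₗ WithBot {x // h x = 0} :=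
    fun x => toLex (k x, if hx : h x = 0 then ((⟨x, hx⟩ : {x // h x = 0}) : WithBot _) else ⊥)
  have hf : Function.Injective f := by
    intro x y hxy
    obtain ⟨h1, h2⟩ := Prod.mk.inj (toLex.injective hxy)
    by_cases hx : k x = 0
    · have hy : k y = 0 := h1 ▸ hx
      rw [dif_pos ((hk x).1 hx), dif_pos ((hk y).1 hy)] at h2
      exact congrArg Subtype.val (WithBot.coe_injective h2)
    · exact hinj x y h1 hx
  refine ⟨LinearOrder.lift' f hf, fun x y hxy => ?_, (eq_of_prefers_imp fun x y hxy => ?_).symm⟩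
  · change f y < f x
    exact Prod.Lex.toLex_lt_toLex.2 (Or.inl hxy)
  · change f y.1 < f x.1
    refine Prod.Lex.toLex_lt_toLex.2
      (Or.inr ⟨((hk _).2 y.2).trans ((hk _).2 x.2).symm, ?_⟩)
    rw [dif_pos y.2, dif_pos x.2]
    exact WithBot.coe_lt_coe.2 hxy

theorem eq_of_layerRespecting {C : Type*} {h : C → SignType}
    (hinj : ∀ x y, h x = h y → h x ≠ 0 → x = y) {V W : LinearOrder C}
    (hV : LayerRespecting h V) (hW : LayerRespecting h W)
    (hm : ∀ x y, h x = 0 → h y = 0 → Prefers V x y → Prefers W x y) : V = W := by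
  refine eq_of_prefers_imp fun x y hxy => ?_
  rcases lt_trichotomy (h x) (h y) with hl | hl | hl
  · exact absurd hxy (hV _ _ hl).asymm
  · by_cases hx : h x = 0
    · exact hm x y hx (hl ▸ hx) hxy
    · exact absurd (hinj x y hl hx) hxy.ne
  · exact hW _ _ hl

/-- A candidate of nonzero layer is alone in an extreme layer, so it can be peeled from any set
containing it; sets without such candidates lie in the middle layer. -/
theorem peelable_of_middle {C : Type*} {h : C → SignType}
    (hinj : ∀ x y, h x = h y → h x ≠ 0 → x = y) {n : ℕ} {P : Profile C n}
    (hP : ∀ j, P j ∈ layeredOrders h) (hM : Peelable fun j => middleOrder h (P j)) :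
    Peelable P := by
  intro C' hC'
  by_cases hex : ∃ c ∈ C', h c ≠ 0
  · obtain ⟨c, hc, hc0⟩ := hex
    refine ⟨c, hc, fun i => ?_⟩
    have hne : ∀ x ∈ C', x ≠ c → h c ≠ h x := fun x _ hx heq => hx (hinj c x heq hc0).symm
    have hlt : (∀ x ∈ C', x ≠ c → h x < h c) ∨ (∀ x ∈ C', x ≠ c → h c < h x) := by
      generalize h c = s at hne hc0
      cases s
      · exact absurd rfl hc0
      · exact Or.inr fun x hx hxc => lt_of_le_of_ne (SignType.neg_one_le _) (hne x hx hxc)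
      · exact Or.inl fun x hx hxc => lt_of_le_of_ne (SignType.le_one _) (hne x hx hxc).symm
    have hneg : ∀ s t : SignType, s < t → -t < -s := by decide
    rcases hP i with hi | hi <;> rcases hlt with hl | hl
    · exact Or.inl fun x hx hxc => hi _ _ (hl x hx hxc)
    · exact Or.inr fun x hx hxc => hi _ _ (hl x hx hxc)
    · exact Or.inr fun x hx hxc => hi _ _ (hneg _ _ (hl x hx hxc))
    · exact Or.inl fun x hx hxc => hi _ _ (hneg _ _ (hl x hx hxc))
  · push Not at hex
    obtain ⟨c, hc⟩ := hC'
    obtain ⟨d, hd, hd'⟩ := hM (Subtype.val ⁻¹' C') ⟨⟨c, hex c hc⟩, hc⟩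
    exact ⟨d, hd, fun i => (hd' i).imp
      (fun H x hx hxd => H ⟨x, hex x hx⟩ hx fun heq => hxd (congrArg Subtype.val heq))
      (fun H x hx hxd => H ⟨x, hex x hx⟩ hx fun heq => hxd (congrArg Subtype.val heq))⟩

theorem not_layerRespecting_neg {C : Type*} {h : C → SignType} (hne : ∃ x y, h x < h y)
    {V : LinearOrder C} (hV : LayerRespecting h V) : ¬ LayerRespecting (-h) V := by
  obtain ⟨x, y, hxy⟩ := hne
  have hneg : ∀ s t : SignType, s < t → -t < -s := by decide
  exact fun hV' => (hV _ _ hxy).asymm (hV' _ _ (hneg _ _ hxy))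

theorem exists_mem_layeredOrders {C : Type*} {h : C → SignType}
    (hinj : ∀ x y, h x = h y → h x ≠ 0 → x = y) (hne : ∃ x y, h x < h y) (p : Prop)
    (U : LinearOrder {x // h x = 0}) :
    ∃ V ∈ layeredOrders h, (LayerRespecting h V ↔ p) ∧ middleOrder h V = U := by
  by_cases hp : p
  · obtain ⟨V, hV, hU⟩ := exists_layerRespecting (fun x => Iff.rfl) hinj U
    exact ⟨V, Or.inl hV, iff_of_true hV hp, hU⟩
  · obtain ⟨V, hV, hU⟩ := exists_layerRespecting (h := h) (k := -h) (fun x => by simp)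
      (fun x y hxy hx => hinj x y (neg_injective hxy) (by simpa using hx)) U
    exact ⟨V, Or.inr hV, iff_of_false (fun h' => not_layerRespecting_neg hne h' hV) hp, hU⟩

theorem eq_of_mem_layeredOrders {C : Type*} {h : C → SignType}
    (hinj : ∀ x y, h x = h y → h x ≠ 0 → x = y) {V W : LinearOrder C}
    (hV : V ∈ layeredOrders h) (hW : W ∈ layeredOrders h)
    (hVW : LayerRespecting h V ↔ LayerRespecting h W)
    (hm : middleOrder h V = middleOrder h W) : V = W := by
  have hm' : ∀ x y, h x = 0 → h y = 0 → Prefers V x y → Prefers W x y := by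
    intro x y hx hy hxy
    have : Prefers (middleOrder h V) ⟨x, hx⟩ ⟨y, hy⟩ := hxy
    rw [hm] at this
    exact this
  by_cases hV' : LayerRespecting h V
  · exact eq_of_layerRespecting hinj hV' (hVW.1 hV') hm'
  · exact eq_of_layerRespecting (h := -h)
      (fun x y hxy hx => hinj x y (neg_injective hxy) (by simpa using hx))
      (hV.resolve_left hV') (hW.resolve_left fun h' => hV' (hVW.2 h'))
      (fun x y hx hy => hm' x y (by simpa using hx) (by simpa using hy))

/-- An election of this kind amounts to the set of voters other than `i` who follow `h` upwards,
together with a peelable election on the middle layer. By `hne`, up and down exclude each other. -/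
theorem ncard_layered {C : Type*} {h : C → SignType}
    (hinj : ∀ x y, h x = h y → h x ≠ 0 → x = y) (hne : ∃ x y, h x < h y) {n : ℕ} (i : Fin n)
    {V : LinearOrder C} (hV : V ∈ layeredOrders h) :
    {P : Profile C n | (Peelable P ∧ P i = V) ∧ ∀ j, P j ∈ layeredOrders h}.ncard =
      2 ^ (n - 1) * peelCount i (middleOrder h V) := by
  have hcard : Nat.card (Set {j // j ≠ i}) = 2 ^ (n - 1) := by
    classical
    rw [Nat.card_eq_fintype_card, Fintype.card_set]
    congr 1
    simp [Fintype.card_subtype_compl]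
  rw [← hcard, peelCount, ← Nat.card_prod, ← Nat.card_coe_set_eq]
  refine Nat.card_congr (Equiv.ofBijective (fun P => ⟨{j | LayerRespecting h (P.1 j.1)},
    ⟨fun j => middleOrder h (P.1 j), P.2.1.1.pull _ _, ?_⟩⟩) ⟨?_, ?_⟩)
  · exact congrArg (middleOrder h) P.2.1.2
  · rintro ⟨P, ⟨hP, hPi⟩, hPl⟩ ⟨Q, ⟨hQ, hQi⟩, hQl⟩ hPQ
    obtain ⟨h1, h2⟩ := Prod.mk.inj hPQ
    have h2' := congrArg Subtype.val h2
    refine Subtype.ext (funext fun j => ?_)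
    by_cases hj : j = i
    · subst hj; exact hPi.trans hQi.symm
    · exact eq_of_mem_layeredOrders hinj (hPl j) (hQl j)
        (Set.ext_iff.1 h1 ⟨j, hj⟩) (congrFun h2' j)
  · rintro ⟨s, Q, hQ, hQi⟩
    choose R hR hRs hRm using fun j =>
      exists_mem_layeredOrders hinj hne (∃ hj : j ≠ i, (⟨j, hj⟩ : {j // j ≠ i}) ∈ s) (Q j)
    classical
    -- The predicate fed to the choice is false at `i`, so `R i` runs downwards whatever `V` does;
    -- it is replaced by `V`.
    have hl : ∀ j, Function.update R i V j ∈ layeredOrders h := by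
      intro j
      by_cases hj : j = i
      · subst hj; simpa using hV
      · simpa [hj] using hR j
    have hm : (fun j => middleOrder h (Function.update R i V j)) = Q := by
      funext j
      by_cases hj : j = i
      · subst hj; simpa using hQi.symm
      · simpa [hj] using hRm j
    refine ⟨⟨Function.update R i V, ⟨peelable_of_middle hinj hl (hm ▸ hQ), by simp⟩, hl⟩, ?_⟩
    refine Prod.ext (Set.ext fun j => ?_) (Subtype.ext hm)
    change LayerRespecting h (Function.update R i V j.1) ↔ _
    rw [Function.update_of_ne j.2, hRs]
    exact ⟨fun ⟨_, h⟩ => h, fun h => ⟨j.2, h⟩⟩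

/-! ### Extreme candidates and the recurrence -/

/-- The preferences that rank `c` first or last. -/
def extremeOrders {C : Type*} (c : C) : Set (LinearOrder C) :=
  {V | (∀ x, x ≠ c → Prefers V c x) ∨ ∀ x, x ≠ c → Prefers V x c}

theorem layeredOrders_single {C : Type*} [DecidableEq C] (c : C) :
    layeredOrders (fun x => if x = c then 1 else 0) = extremeOrders c := by
  ext V
  refine or_congr ⟨fun h x hx => h _ _ (by simp [hx]), fun h x y hxy => ?_⟩
    ⟨fun h x hx => h _ _ (by simp [hx]), fun h x y hxy => ?_⟩
  · by_cases hx : x = c <;> by_cases hy : y = c <;> simp [hx, hy] at hxy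
    subst hx
    exact h y hy
  · by_cases hx : x = c <;> by_cases hy : y = c <;> simp [hx, hy] at hxy
    subst hy
    exact h x hx

theorem layeredOrders_pair {C : Type*} [DecidableEq C] {t b : C} (htb : t ≠ b) :
    layeredOrders (fun x => if x = t then 1 else if x = b then -1 else 0) =
      extremeOrders t ∩ extremeOrders b := by
  have h1 : ∀ V : LinearOrder C,
      LayerRespecting (fun x => if x = t then 1 else if x = b then -1 else 0) V ↔
        (∀ x, x ≠ t → Prefers V t x) ∧ ∀ x, x ≠ b → Prefers V x b := by
    refine fun V => ⟨fun h => ⟨fun x hx => h _ _ ?_, fun x hx => h _ _ ?_⟩,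
      fun ⟨ht, hb⟩ x y hxy => ?_⟩
    · by_cases hxb : x = b <;> simp [hx, hxb, htb.symm]
    · by_cases hxt : x = t <;> simp [hx, hxt, htb.symm]
    · by_cases hx : x = t
      · exact hx ▸ ht y fun hy => by simp [hx, hy] at hxy
      · by_cases hy : y = b
        · exact hy ▸ hb x fun hx' => by simp [hx', hy] at hxy
        · by_cases hx' : x = b <;> by_cases hy' : y = t <;> simp [hx, hy, hx', hy', htb.symm] at hxy
  have h2 : ∀ V : LinearOrder C,
      LayerRespecting (-fun x => if x = t then 1 else if x = b then -1 else 0) V ↔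
        (∀ x, x ≠ t → Prefers V x t) ∧ ∀ x, x ≠ b → Prefers V b x := by
    refine fun V => ⟨fun h => ⟨fun x hx => h _ _ ?_, fun x hx => h _ _ ?_⟩,
      fun ⟨ht, hb⟩ x y hxy => ?_⟩
    · by_cases hxb : x = b <;> simp [hx, hxb, htb.symm]
    · by_cases hxt : x = t <;> simp [hx, hxt, htb.symm]
    · by_cases hy : y = t
      · exact hy ▸ ht x fun hx => by simp [hx, hy] at hxy
      · by_cases hx : x = b
        · exact hx ▸ hb y fun hy' => by simp [hx, hy'] at hxy
        · by_cases hx' : x = t <;> by_cases hy' : y = b <;> simp [hx, hy, hx', hy', htb.symm] at hxy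
  ext V
  refine (or_congr (h1 V) (h2 V)).trans ⟨?_, ?_⟩
  · rintro (⟨ht, hb⟩ | ⟨ht, hb⟩)
    · exact ⟨Or.inl ht, Or.inr hb⟩
    · exact ⟨Or.inr ht, Or.inl hb⟩
  · rintro ⟨ht | ht, hb | hb⟩
    · exact absurd (ht b htb.symm) (hb t htb).asymm
    · exact Or.inl ⟨ht, hb⟩
    · exact Or.inr ⟨ht, hb⟩
    · exact absurd (ht b htb.symm) (hb t htb).asymm

/-- Stated additively to avoid truncated subtraction. -/
theorem peelCount_recurrence {C : Type*} [Fintype C] (hC : 2 ≤ Fintype.card C) {n : ℕ}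
    (i : Fin n) (V : LinearOrder C) {D E : Type*} [Fintype D] [Fintype E]
    (hD : Fintype.card D + 1 = Fintype.card C) (hE : Fintype.card E + 2 = Fintype.card C)
    (V' : LinearOrder D) (V'' : LinearOrder E) :
    peelCount i V + 2 ^ (n - 1) * peelCount i V'' = 2 ^ n * peelCount i V' := by
  classical
  have : Nontrivial C := Fintype.one_lt_card_iff_nontrivial.1 hC
  obtain ⟨t, -, ht⟩ := exists_top_mem V (Set.univ_nonempty (α := C))
  obtain ⟨b, -, hb⟩ := exists_bottom_mem V (Set.univ_nonempty (α := C))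
  have htb : t ≠ b := by
    rintro rfl
    obtain ⟨d, hd⟩ := exists_ne t
    exact (ht d trivial hd).asymm (hb d trivial hd)
  have hVt : V ∈ extremeOrders t := Or.inl fun x => ht x trivial
  have hVb : V ∈ extremeOrders b := Or.inr fun x => hb x trivial
  let S : C → Set (Profile C n) := fun c =>
    {P | (Peelable P ∧ P i = V) ∧ ∀ j, P j ∈ extremeOrders c}
  have hS : ∀ c, V ∈ extremeOrders c → (S c).ncard = 2 ^ (n - 1) * peelCount i V' := by
    intro c hc
    rw [← layeredOrders_single] at hc
    obtain ⟨d, hd⟩ := exists_ne c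
    simp only [S]
    rw [← layeredOrders_single, ncard_layered _ _ i hc, peelCount_eq i i _ _ V']
    · have : Fintype.card {x : C // x ≠ c} = Fintype.card C - 1 := by
        simp [Fintype.card_subtype_compl]
      simp
      omega
    · intro x y
      by_cases hx : x = c <;> by_cases hy : y = c <;> simp [hx, hy]
    · exact ⟨d, c, by simp [hd]⟩
  have hI : (S t ∩ S b).ncard = 2 ^ (n - 1) * peelCount i V'' := by
    have hV : V ∈ extremeOrders t ∩ extremeOrders b := ⟨hVt, hVb⟩
    have : S t ∩ S b =
        {P | (Peelable P ∧ P i = V) ∧ ∀ j, P j ∈ extremeOrders t ∩ extremeOrders b} := by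
      ext P
      simp only [S, Set.mem_inter_iff, Set.mem_ofPred_eq, forall_and]
      tauto
    rw [this]
    rw [← layeredOrders_pair htb] at hV ⊢
    rw [ncard_layered _ _ i hV, peelCount_eq i i _ _ V'']
    · have h1 : ∀ x : C, ((if x = t then 1 else if x = b then -1 else 0 : SignType) = 0) ↔
          x ∉ ({t, b} : Finset C) := by
        intro x
        by_cases hx : x = t <;> by_cases hy : x = b <;> simp [hx, hy, htb.symm]
      rw [Fintype.card_congr (Equiv.subtypeEquivRight h1), Fintype.card_subtype,
        Finset.filter_not, Finset.filter_mem_eq_inter, Finset.univ_inter,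
        Finset.card_univ_sdiff, Finset.card_pair htb]
      omega
    · intro x y
      by_cases hx : x = t <;> by_cases hy : y = t <;> by_cases hx' : x = b <;>
        by_cases hy' : y = b <;> simp [hx, hy, hx', hy'] <;> simp_all
    · exact ⟨b, t, by simp [htb.symm]⟩
  -- Peeling the full candidate set gives some `c`; voter `i` ranks it first or last, so `c` is `t`
  -- or `b`.
  have hU : {P : Profile C n | Peelable P ∧ P i = V} = S t ∪ S b := by
    ext P
    refine ⟨fun hP => ?_, fun hP => hP.elim And.left And.left⟩
    obtain ⟨c, -, hc⟩ := hP.1 Set.univ Set.univ_nonempty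
    have hc' : ∀ j, P j ∈ extremeOrders c := fun j =>
      (hc j).imp (fun h x => h x trivial) (fun h x => h x trivial)
    have hci := hc' i
    rw [hP.2] at hci
    rcases hci with h | h
    · obtain rfl : c = t := by
        by_contra hne
        exact (h t (Ne.symm hne)).asymm (ht c trivial hne)
      exact Or.inl ⟨hP, hc'⟩
    · obtain rfl : c = b := by
        by_contra hne
        exact (h b (Ne.symm hne)).asymm (hb c trivial hne)
      exact Or.inr ⟨hP, hc'⟩
  have hcnt : peelCount i V = (S t ∪ S b).ncard := by
    rw [← hU, ← Nat.card_coe_set_eq]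
    rfl
  -- The voter `i` forces `n` to be positive.
  have hn : 2 ^ n = 2 * 2 ^ (n - 1) := by
    rw [← pow_succ', Nat.sub_add_cancel (Nat.one_le_of_lt i.isLt)]
  rw [hcnt, ← hI, Set.ncard_union_add_ncard_inter, hS t hVt, hS b hVb, hn]
  ring

/-! ### The total count -/

theorem card_linearOrder (m : ℕ) : Nat.card (LinearOrder (Fin m)) = m.factorial := by
  let V₀ : LinearOrder (Fin m) := inferInstance
  have : Function.Bijective fun e : Equiv.Perm (Fin m) => pullOrder e e.injective V₀ := by
    refine ⟨fun e e' h => ?_, fun W => exists_pullOrder_eq rfl V₀ W⟩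
    have h' : ∀ x y, e x < e y → e' x < e' y := fun x y hxy => by
      have h1 : Prefers (pullOrder e e.injective V₀) y x := hxy
      have h2 : pullOrder e e.injective V₀ = pullOrder e' e'.injective V₀ := h
      rw [h2] at h1
      exact h1
    -- Permutations inducing the same order differ by an automorphism of the chain `Fin m`, which
    -- must be the identity.
    have hmono : StrictMono fun x => e' (e.symm x) := fun x y hxy => h' _ _ (by simpa using hxy)
    have hsurj : Function.Surjective fun x => e' (e.symm x) :=
      e'.surjective.comp e.symm.surjective
    have hid := Subsingleton.elim (StrictMono.orderIsoOfSurjective _ hmono hsurj)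
      (OrderIso.refl _)
    ext x
    have := congrArg (fun o : Fin m ≃o Fin m => o (e x)) hid
    simp at this
    rw [this]
  rw [← Nat.card_congr (Equiv.ofBijective _ this), Nat.card_perm, Nat.card_fin]

theorem enrichedFixedCount_eq_peelCount {m n : ℕ} (i : Fin n) (V : LinearOrder (Fin m)) :
    enrichedFixedCount m n i V = peelCount i V :=
  Nat.card_congr (Equiv.subtypeEquivRight fun _ =>
    and_congr_left fun _ => enrichedGroupSeparable_iff_peelable i)

theorem peelCount_of_subsingleton {C : Type*} [Subsingleton C] {n : ℕ} (i : Fin n)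
    (V : LinearOrder C) : peelCount i V = 1 := by
  have hs : Subsingleton (LinearOrder C) := ⟨fun V W => eq_of_prefers_imp fun x y h =>
    absurd (Subsingleton.elim x y) h.ne⟩
  have : Unique {P : Profile C n // Peelable P ∧ P i = V} :=
    { default := ⟨fun _ => V, fun C' ⟨c, hc⟩ => ⟨c, hc, fun _ => Or.inl fun x _ hne =>
        absurd (Subsingleton.elim x c) hne⟩, rfl⟩
      uniq := fun _ => Subsingleton.elim _ _ }
  exact Nat.card_unique

/-- Elections are fibred over the preference of voter `i`, and all fibres have equal size by
`peelCount_eq`. -/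
theorem enrichedCount_eq (m n : ℕ) (i : Fin n) (V : LinearOrder (Fin m)) :
    enrichedCount m n = m.factorial * enrichedFixedCount m n i V := by
  have e : {P : Profile (Fin m) n // EnrichedGroupSeparable P} ≃
      Σ W : LinearOrder (Fin m), {P : Profile (Fin m) n // EnrichedGroupSeparable P ∧ P i = W} :=
    { toFun := fun P => ⟨P.1 i, P.1, P.2, rfl⟩
      invFun := fun Q => ⟨Q.2.1, Q.2.2.1⟩
      left_inv := fun _ => rfl
      right_inv := by rintro ⟨_, P, hP, rfl⟩; rfl }
  have := Fintype.ofFinite (LinearOrder (Fin m))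
  have hW : ∀ W : LinearOrder (Fin m),
      Nat.card {P : Profile (Fin m) n // EnrichedGroupSeparable P ∧ P i = W} =
        enrichedFixedCount m n i V := fun W => by
    change enrichedFixedCount m n i W = _
    rw [enrichedFixedCount_eq_peelCount, enrichedFixedCount_eq_peelCount]
    exact peelCount_eq i i rfl W V
  rw [enrichedCount, Nat.card_congr e, Nat.card_sigma, Finset.sum_congr rfl fun W _ => hW W,
    Finset.sum_const, Finset.card_univ, ← Nat.card_eq_fintype_card, card_linearOrder, smul_eq_mul]

theorem mainTheorem3 (n : ℕ) (hn : 1 ≤ n) :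
    -- the number with one fixed preference depends neither on the voter nor on the preference
    (∀ (m : ℕ) (i j : Fin n) (V W : LinearOrder (Fin m)),
      enrichedFixedCount m n i V = enrichedFixedCount m n j W) ∧
    -- initial conditions
    (∀ (i : Fin n) (V : LinearOrder (Fin 0)), enrichedFixedCount 0 n i V = 1) ∧
    (∀ (i : Fin n) (V : LinearOrder (Fin 1)), enrichedFixedCount 1 n i V = 1) ∧
    -- recurrence
    (∀ (m : ℕ) (i : Fin n) (V : LinearOrder (Fin (m + 2))) (V' : LinearOrder (Fin (m + 1)))
        (V'' : LinearOrder (Fin m)),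
      (enrichedFixedCount (m + 2) n i V : ℤ) =
        2 ^ n * enrichedFixedCount (m + 1) n i V' - 2 ^ (n - 1) * enrichedFixedCount m n i V'') ∧
    -- total number
    (∀ (m : ℕ) (i : Fin n) (V : LinearOrder (Fin m)),
      enrichedCount m n = m.factorial * enrichedFixedCount m n i V) := by
  refine ⟨fun m i j V W => ?_, fun i V => ?_, fun i V => ?_, fun m i V V' V'' => ?_,
    fun m i V => enrichedCount_eq m n i V⟩
  · rw [enrichedFixedCount_eq_peelCount, enrichedFixedCount_eq_peelCount]
    exact peelCount_eq i j rfl V W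
  · rw [enrichedFixedCount_eq_peelCount, peelCount_of_subsingleton]
  · rw [enrichedFixedCount_eq_peelCount, peelCount_of_subsingleton]
  · simp only [enrichedFixedCount_eq_peelCount]
    have := peelCount_recurrence (by simp) i V (by simp) (by simp) V' V''
    zify at this
    linarith
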